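/- Let $\Omega$ be a finite set, $P_0$ a probability distribution on $\Omega$ with $P_0(x)>0$ for all $x\in\Omega$, and $T$ a proposal kernel on $\Omega$, that is, $T(x,y)\in(0,1)$ for all $x,y\in\Omega$ and $\sum_{y\in\Omega}T(x,y)=1$ for all $x\in\Omega$ (so $|\Omega|\ge 2$). For $L:\Omega\to(0,\infty)$ let $P_L(x)=P_0(x)e^{-L(x)}/\sum_{y\in\Omega}P_0(y)e^{-L(y)}$, and let $\mathcal C_L$ be the Metropolis–Hastings chain with target $P_L$ and proposal $T$, that is, the Markov chain on $\Omega$ with transition matrix $$W_{x,y}=T(x,y)A(x,y)\ (x\neq y),\qquad W_{x,x}=1-\sum_{z\neq x}T(x,z)A(x,z),\qquad A(x,y)=\min\Bigl\{1,\frac{P_L(y)T(y,x)}{P_L(x)T(x,y)}\Bigr\}.$$ Its spectral gap is $\Delta=1-|\lambda_1|$, where $\lambda_1$ is the eigenvalue of $W$ with the second largest modulus (eigenvalues counted with multiplicity). Let $L,\tilde L:\Omega\to(0,\infty)$, $P=P_L$, $\tilde P=P_{\tilde L}$, let $\Delta$ be the spectral gap of $\mathcal C_L$ and $P_{\min}=\min_{x\in\Omega}P(x)$.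 Then $P$ and $\tilde P$ are the unique stationary distributions of $\mathcal C_L$ and $\mathcal C_{\tilde L}$, respectively, $0<\Delta\le1$, and $$\|\tilde P-P\|_{\rm TV}\le 8\left(\left\lceil\frac{\log(2\sqrt{P_{\min}})}{\log(1-\Delta)}\right\rceil+\frac1\Delta\right)\max_{x\in\Omega}|\tilde L(x)-L(x)|,$$ where $\|\tilde P-P\|_{\rm TV}=\max_{A\subseteq\Omega}|\tilde P(A)-P(A)|$, and the quotient of logarithms is read as $0$ if $\Delta=1$. -/

import Mathlib

noncomputable section

namespace MetropolisHastings

variable {Ω : Type*} [Fintype Ω]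

/-- The probability distribution proportional to `P₀ * exp (-L)`. -/
def target (P₀ L : Ω → ℝ) (x : Ω) : ℝ :=
  P₀ x * Real.exp (-L x) / ∑ y, P₀ y * Real.exp (-L y)

/-- The acceptance ratio for the target distribution `P` and the proposal `T`. -/
def accept (P : Ω → ℝ) (T : Matrix Ω Ω ℝ) (x y : Ω) : ℝ :=
  min 1 (P y * T y x / (P x * T x y))

/-- The Metropolis-Hastings transition matrix for the target distribution `P` and the proposal
`T`; the entry `(x, y)` is the probability of a transition from `x` to `y`. -/
def transition [DecidableEq Ω] (P : Ω → ℝ) (T : Matrix Ω Ω ℝ) : Matrix Ω Ω ℝ := fun x y =>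
  if x = y then 1 - ∑ z ∈ Finset.univ.erase x, T x z * accept P T x z
  else T x y * accept P T x y

/-- `p` is a probability distribution that is invariant under the transition matrix `W`. -/
def IsStationary (W : Matrix Ω Ω ℝ) (p : Ω → ℝ) : Prop :=
  p ∈ stdSimplex ℝ Ω ∧ Matrix.vecMul p W = p

/-- The moduli of the complex eigenvalues of `W`, counted with algebraic multiplicity, in
decreasing order. -/
def eigenvalueModuli [DecidableEq Ω] (W : Matrix Ω Ω ℝ) : List ℝ :=
  ((W.map Complex.ofReal).charpoly.roots.map fun z => ‖z‖).sort (· ≥ ·)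

/-- One minus the second largest modulus of an eigenvalue of `W` (only used when there are at
least two states). -/
def spectralGap [DecidableEq Ω] (W : Matrix Ω Ω ℝ) : ℝ :=
  1 - (eigenvalueModuli W).getD 1 0

/-- The total variation distance: the maximum over all events `A` of `|p A - q A|`. -/
def tvDist (p q : Ω → ℝ) : ℝ :=
  ⨆ A : Finset Ω, |∑ x ∈ A, p x - ∑ x ∈ A, q x|

end MetropolisHastings

end

namespace MetropolisHastings

/-! ### Acceptance probabilities -/

section Accept

variable {Ω : Type*} {P : Ω → ℝ} {T : Matrix Ω Ω ℝ}

/-! The perturbation bound needs no mixing argument. If `|L' - L| ≤ ε`, the two targets differ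
pointwise by a factor of at least `exp (-2ε)`, so their distance is at most `2ε`
(`tvDist_target_le`). The prefactor is at least 4, since ceiling plus `1/Δ` is at least `1/2`
(`half_le_ceil_add_inv`). The spectral gap enters only through `0 < Δ ≤ 1`.

The statements about the chain come from reversibility and strict positivity of the transition
matrix. By the maximum principle `eigenvector_const`, eigenvectors for eigenvalues of modulus at
least 1 are constant. This gives uniqueness of the stationary law and, after symmetrization, at most
one such eigenvalue with multiplicity. -/

theorem accept_pos (hP : ∀ x, 0 < P x) (hT : ∀ x y, 0 < T x y) (x y : Ω) :
    0 < accept P T x y :=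
  lt_min one_pos (div_pos (mul_pos (hP y) (hT y x)) (mul_pos (hP x) (hT x y)))

theorem accept_le_one (P : Ω → ℝ) (T : Matrix Ω Ω ℝ) (x y : Ω) : accept P T x y ≤ 1 :=
  min_le_left _ _

/-- The right side is symmetric in `x` and `y`: this is detailed balance. -/
theorem mul_accept (hP : ∀ x, 0 < P x) (hT : ∀ x y, 0 < T x y) (x y : Ω) :
    P x * (T x y * accept P T x y) = min (P x * T x y) (P y * T y x) := by
  have h := mul_pos (hP x) (hT x y)
  rw [accept, ← mul_assoc, mul_min_of_nonneg _ _ h.le, mul_one, mul_div_cancel₀ _ h.ne']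

end Accept

variable {Ω : Type*} [Fintype Ω]

/-! ### Positive reversible stochastic matrices -/

section PositiveStochastic

/-- Maximum principle: an eigenvector of a positive stochastic matrix for an eigenvalue of modulus
at least one is constant. -/
theorem eigenvector_const {W : Matrix Ω Ω ℝ} (hpos : ∀ x y, 0 < W x y)
    (hsum : ∀ x, ∑ y, W x y = 1) {u : Ω → ℝ} {c : ℝ} (hc : 1 ≤ |c|)
    (hu : Matrix.mulVec W u = c • u) (x y : Ω) : u x = u y := by
  obtain ⟨m, -, hm⟩ := Finset.exists_max_image Finset.univ (fun z => |u z|) ⟨x, Finset.mem_univ x⟩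
  have hm' : ∀ z, |u z| ≤ |u m| := fun z => hm z (Finset.mem_univ z)
  have hrow : ∑ z, W m z * u z = c * u m := by
    have := congrFun hu m
    simpa [Matrix.mulVec, dotProduct] using this
  -- `s` is the sign of `c * u m`. The nonnegative terms `W m z * (|u m| - s * u z)` sum to `(1 -
  -- |c|) * |u m| ≤ 0`, so all vanish.
  have key : ∀ s : ℝ, |s| = 1 → s * (c * u m) = |c * u m| → ∀ z, s * u z = |u m| := by
    intro s hs hsm
    have hnonneg : ∀ z ∈ Finset.univ, 0 ≤ W m z * (|u m| - s * u z) := by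
      intro z _
      refine mul_nonneg (hpos m z).le (sub_nonneg.2 ?_)
      calc s * u z ≤ |s * u z| := le_abs_self _
        _ = |u z| := by rw [abs_mul, hs, one_mul]
        _ ≤ |u m| := hm' z
    have htotal : ∑ z, W m z * (|u m| - s * u z) = |u m| - |c| * |u m| := by
      have : ∀ z, W m z * (|u m| - s * u z) = W m z * |u m| - s * (W m z * u z) :=
        fun z => by ring
      simp_rw [this]
      rw [Finset.sum_sub_distrib, ← Finset.sum_mul, ← Finset.mul_sum, hsum, hrow, hsm, abs_mul,
        one_mul]
    have hle : ∑ z, W m z * (|u m| - s * u z) ≤ 0 := by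
      rw [htotal]
      nlinarith [abs_nonneg (u m)]
    have hzero := (Finset.sum_eq_zero_iff_of_nonneg hnonneg).1
      (le_antisymm hle (Finset.sum_nonneg hnonneg))
    intro z
    have := (mul_eq_zero.1 (hzero z (Finset.mem_univ z))).resolve_left (hpos m z).ne'
    linarith
  rcases le_total 0 (c * u m) with h | h
  · have k := key 1 (by simp) (by rw [abs_of_nonneg h, one_mul])
    linarith [k x, k y]
  · have k := key (-1) (by simp) (by rw [abs_of_nonpos h]; ring)
    linarith [k x, k y]

/-- Passing to densities with respect to `P` turns invariant row vectors into harmonic functions. -/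
theorem mulVec_div_of_reversible {W : Matrix Ω Ω ℝ} {P p : Ω → ℝ} (hP : ∀ x, 0 < P x)
    (hrev : ∀ x y, P x * W x y = P y * W y x) (hp : Matrix.vecMul p W = p) :
    Matrix.mulVec W (fun x => p x / P x) = fun x => p x / P x := by
  funext x
  have hx : ∑ y, p y * W y x = p x := by
    simpa [Matrix.vecMul, dotProduct] using congrFun hp x
  simp only [Matrix.mulVec, dotProduct]
  rw [← hx, Finset.sum_div]
  refine Finset.sum_congr rfl fun y _ => ?_
  have := (hP x).ne'
  have := (hP y).ne'
  field_simp
  linear_combination p y * hrev x y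

theorem isStationary_iff {W : Matrix Ω Ω ℝ} {P : Ω → ℝ} (hpos : ∀ x y, 0 < W x y)
    (hsum : ∀ x, ∑ y, W x y = 1) (hP : ∀ x, 0 < P x) (hPsum : ∑ x, P x = 1)
    (hrev : ∀ x y, P x * W x y = P y * W y x) (p : Ω → ℝ) : IsStationary W p ↔ p = P := by
  constructor
  · rintro ⟨⟨-, hp1⟩, hp⟩
    have hu : Matrix.mulVec W (fun x => p x / P x) = (1 : ℝ) • fun x => p x / P x := by
      rw [one_smul, mulVec_div_of_reversible hP hrev hp]
    have hconst := eigenvector_const hpos hsum (by simp) hu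
    funext x
    have hy : ∀ y, p y = p x / P x * P y := fun y => by
      have h : p y / P y = p x / P x := hconst y x
      rw [← h, div_mul_cancel₀ _ (hP y).ne']
    have h1 : p x / P x = 1 := by
      have : ∑ y, p y = p x / P x * ∑ y, P y := by
        rw [Finset.mul_sum]
        exact Finset.sum_congr rfl fun y _ => hy y
      rw [hp1, hPsum, mul_one] at this
      exact this.symm
    rw [hy x, h1, one_mul]
  · rintro rfl
    refine ⟨⟨fun x => (hP x).le, hPsum⟩, ?_⟩
    funext x
    simp only [Matrix.vecMul, dotProduct]
    rw [Finset.sum_congr rfl fun y _ => hrev y x, ← Finset.mul_sum, hsum, mul_one]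

variable [DecidableEq Ω]

/-- The symmetrization of a matrix that is reversible with respect to `P`. -/
noncomputable def symmetrization (P : Ω → ℝ) (W : Matrix Ω Ω ℝ) : Matrix Ω Ω ℝ :=
  Matrix.diagonal (fun x => √(P x)) * W * Matrix.diagonal (fun x => (√(P x))⁻¹)

theorem symmetrization_apply (P : Ω → ℝ) (W : Matrix Ω Ω ℝ) (x y : Ω) :
    symmetrization P W x y = √(P x) * W x y * (√(P y))⁻¹ := by
  rw [symmetrization, Matrix.mul_diagonal, Matrix.diagonal_mul]

theorem charpoly_symmetrization {P : Ω → ℝ} (hP : ∀ x, 0 < P x) (W : Matrix Ω Ω ℝ) :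
    (symmetrization P W).charpoly = W.charpoly := by
  have h : Matrix.diagonal (fun x => (√(P x))⁻¹) * Matrix.diagonal (fun x => √(P x)) = 1 := by
    rw [Matrix.diagonal_mul_diagonal, ← Matrix.diagonal_one]
    congr 1
    funext x
    exact inv_mul_cancel₀ (Real.sqrt_pos.2 (hP x)).ne'
  rw [symmetrization, Matrix.charpoly_mul_comm, ← mul_assoc, h, one_mul]

theorem isHermitian_symmetrization {W : Matrix Ω Ω ℝ} {P : Ω → ℝ} (hP : ∀ x, 0 < P x)
    (hrev : ∀ x y, P x * W x y = P y * W y x) : (symmetrization P W).IsHermitian := by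
  refine Matrix.IsHermitian.ext fun x y => ?_
  rw [star_trivial, symmetrization_apply, symmetrization_apply]
  have hx := Real.sqrt_pos.2 (hP x)
  have hy := Real.sqrt_pos.2 (hP y)
  have h := hrev x y
  rw [← Real.mul_self_sqrt (hP x).le, ← Real.mul_self_sqrt (hP y).le] at h
  field_simp
  linear_combination -h

/-- Both eigenvectors would be nonzero multiples of `√P`, hence not orthogonal. Comparing indices
rather than values accounts for multiplicity. -/
theorem eigenvalue_subsingleton {W : Matrix Ω Ω ℝ} {P : Ω → ℝ} (hpos : ∀ x y, 0 < W x y)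
    (hsum : ∀ x, ∑ y, W x y = 1) (hP : ∀ x, 0 < P x) (hS : (symmetrization P W).IsHermitian)
    {i j : Ω} (hi : 1 ≤ |hS.eigenvalues i|) (hj : 1 ≤ |hS.eigenvalues j|) : i = j := by
  have hs : ∀ x, 0 < √(P x) := fun x => Real.sqrt_pos.2 (hP x)
  have hform : ∀ k, 1 ≤ |hS.eigenvalues k| →
      ∃ a : ℝ, ∀ x, hS.eigenvectorBasis k x = a * √(P x) := by
    intro k hk
    have hev := hS.mulVec_eigenvectorBasis k
    have hu : Matrix.mulVec W (fun x => (√(P x))⁻¹ * hS.eigenvectorBasis k x) =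
        hS.eigenvalues k • fun x => (√(P x))⁻¹ * hS.eigenvectorBasis k x := by
      funext x
      have hx := congrFun hev x
      simp only [Matrix.mulVec, dotProduct, symmetrization_apply, Pi.smul_apply,
        smul_eq_mul] at hx ⊢
      rw [mul_left_comm, ← hx, Finset.mul_sum]
      refine Finset.sum_congr rfl fun y _ => ?_
      have := (hs x).ne'
      field_simp
    have hconst := eigenvector_const hpos hsum hk hu
    refine ⟨(√(P i))⁻¹ * hS.eigenvectorBasis k i, fun x => ?_⟩
    have h : (√(P i))⁻¹ * hS.eigenvectorBasis k i = (√(P x))⁻¹ * hS.eigenvectorBasis k x :=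
      hconst i x
    have := (hs x).ne'
    rw [h]
    field_simp
  obtain ⟨a, ha⟩ := hform i hi
  obtain ⟨b, hb⟩ := hform j hj
  by_contra hij
  have hinner : inner ℝ (hS.eigenvectorBasis i) (hS.eigenvectorBasis j) = 0 :=
    hS.eigenvectorBasis.orthonormal.2 hij
  have hne : ∀ k (a : ℝ), (∀ x, hS.eigenvectorBasis k x = a * √(P x)) → a ≠ 0 := by
    rintro k a h rfl
    refine hS.eigenvectorBasis.orthonormal.ne_zero k ?_
    ext x
    simp [h x]
  have hval : inner ℝ (hS.eigenvectorBasis i) (hS.eigenvectorBasis j) = b * a * ∑ x, P x := by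
    rw [PiLp.inner_apply, Finset.mul_sum]
    refine Finset.sum_congr rfl fun x _ => ?_
    simp only [ha, hb, RCLike.inner_apply, conj_trivial]
    linear_combination a * b * Real.mul_self_sqrt (hP x).le
  have hPpos : 0 < ∑ x, P x := Finset.sum_pos (fun x _ => hP x) ⟨i, Finset.mem_univ i⟩
  rw [hinner] at hval
  exact mul_ne_zero (mul_ne_zero (hne j b hb) (hne i a ha)) hPpos.ne' hval.symm

theorem eigenvalueModuli_eq {W : Matrix Ω Ω ℝ} {P : Ω → ℝ} (hP : ∀ x, 0 < P x)
    (hS : (symmetrization P W).IsHermitian) :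
    eigenvalueModuli W =
      (Finset.univ.val.map fun i => |hS.eigenvalues i|).sort (· ≥ ·) := by
  have hroots : (W.map Complex.ofReal).charpoly.roots =
      Finset.univ.val.map fun i => (hS.eigenvalues i : ℂ) := by
    have h1 : (W.map Complex.ofReal).charpoly = W.charpoly.map Complex.ofRealHom :=
      Matrix.charpoly_map W Complex.ofRealHom
    have h2 := Polynomial.roots_multiset_prod_X_sub_C
      (Finset.univ.val.map fun i => (hS.eigenvalues i : ℂ))
    rw [Multiset.map_map] at h2
    rw [h1, ← charpoly_symmetrization hP, hS.charpoly_eq, Polynomial.map_prod]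
    simp only [Polynomial.map_sub, Polynomial.map_X, Polynomial.map_C]
    exact h2
  rw [eigenvalueModuli, hroots, Multiset.map_map]
  simp

theorem spectralGap_mem_Ioc {W : Matrix Ω Ω ℝ} {P : Ω → ℝ} (hpos : ∀ x y, 0 < W x y)
    (hsum : ∀ x, ∑ y, W x y = 1) (hP : ∀ x, 0 < P x)
    (hrev : ∀ x y, P x * W x y = P y * W y x) : spectralGap W ∈ Set.Ioc (0 : ℝ) 1 := by
  have hS := isHermitian_symmetrization hP hrev
  set m : Multiset ℝ := Finset.univ.val.map fun i => |hS.eigenvalues i| with hm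
  have hl : eigenvalueModuli W = m.sort (· ≥ ·) := eigenvalueModuli_eq hP hS
  have hcard : (m.filter (1 ≤ ·)).card ≤ 1 := by
    rw [hm, Multiset.filter_map, Multiset.card_map]
    change (Finset.univ.filter fun i => 1 ≤ |hS.eigenvalues i|).card ≤ 1
    refine Finset.card_le_one.2 fun i hi j hj => ?_
    exact eigenvalue_subsingleton hpos hsum hP hS (Finset.mem_filter.1 hi).2
      (Finset.mem_filter.1 hj).2
  have hnonneg : ∀ a ∈ m.sort (· ≥ ·), 0 ≤ a := by
    intro a ha
    rw [Multiset.mem_sort, hm, Multiset.mem_map] at ha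
    obtain ⟨i, -, rfl⟩ := ha
    exact abs_nonneg _
  have hsorted : (m.sort (· ≥ ·)).Pairwise (· ≥ ·) := Multiset.pairwise_sort m (· ≥ ·)
  have hcoe : ((m.sort (· ≥ ·) : List ℝ) : Multiset ℝ) = m := Multiset.sort_eq m (· ≥ ·)
  rw [spectralGap, hl]
  generalize m.sort (· ≥ ·) = l at *
  -- With fewer than two entries, `getD` returns 0 and the gap is 1.
  match l with
  | [] => simp
  | [a] => simp
  | a :: b :: t =>
    have hab : b ≤ a := (List.pairwise_cons.1 hsorted).1 b (by simp)
    have hb : b < 1 := by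
      by_contra! hb
      rw [← hcoe] at hcard
      have ha : 1 ≤ a := hb.trans hab
      simp [ha, hb] at hcard
    have hb0 := hnonneg b (by simp)
    simp only [List.getD_cons_succ, List.getD_cons_zero, Set.mem_Ioc]
    constructor <;> linarith

end PositiveStochastic

/-! ### The Metropolis–Hastings matrix -/

section Transition

variable [DecidableEq Ω] {P : Ω → ℝ} {T : Matrix Ω Ω ℝ}

theorem transition_reversible (hP : ∀ x, 0 < P x) (hT : ∀ x y, 0 < T x y) (x y : Ω) :
    P x * transition P T x y = P y * transition P T y x := by
  rcases eq_or_ne x y with rfl | h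
  · rfl
  · rw [transition, transition, if_neg h, if_neg h.symm, mul_accept hP hT, mul_accept hP hT,
      min_comm]

theorem transition_pos (hP : ∀ x, 0 < P x) (hT : ∀ x y, 0 < T x y) (hTsum : ∀ x, ∑ y, T x y = 1)
    (x y : Ω) : 0 < transition P T x y := by
  rw [transition]
  split_ifs with h
  -- The holding probability is at least `T x x > 0`.
  · have h1 : ∑ z ∈ Finset.univ.erase x, T x z * accept P T x z ≤
        ∑ z ∈ Finset.univ.erase x, T x z :=
      Finset.sum_le_sum fun z _ => mul_le_of_le_one_right (hT x z).le (accept_le_one P T x z)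
    have h2 := Finset.add_sum_erase Finset.univ (T x) (Finset.mem_univ x)
    rw [hTsum] at h2
    linarith [hT x x]
  · exact mul_pos (hT x y) (accept_pos hP hT x y)

theorem transition_row_sum (P : Ω → ℝ) (T : Matrix Ω Ω ℝ) (x : Ω) :
    ∑ y, transition P T x y = 1 := by
  rw [← Finset.add_sum_erase Finset.univ _ (Finset.mem_univ x)]
  have h : ∑ y ∈ Finset.univ.erase x, transition P T x y =
      ∑ y ∈ Finset.univ.erase x, T x y * accept P T x y :=
    Finset.sum_congr rfl fun y hy => if_neg (Finset.ne_of_mem_erase hy).symm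
  rw [h, transition, if_pos rfl, sub_add_cancel]

end Transition

/-! ### Perturbation of the target -/

section Target

variable {P₀ : Ω → ℝ}

theorem partition_pos [Nonempty Ω] (hP₀ : ∀ x, 0 < P₀ x) (L : Ω → ℝ) :
    0 < ∑ y, P₀ y * Real.exp (-L y) :=
  Finset.sum_pos (fun y _ => mul_pos (hP₀ y) (Real.exp_pos _)) Finset.univ_nonempty

theorem target_pos (hP₀ : ∀ x, 0 < P₀ x) (L : Ω → ℝ) (x : Ω) : 0 < target P₀ L x :=
  have : Nonempty Ω := ⟨x⟩
  div_pos (mul_pos (hP₀ x) (Real.exp_pos _)) (partition_pos hP₀ L)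

theorem sum_target [Nonempty Ω] (hP₀ : ∀ x, 0 < P₀ x) (L : Ω → ℝ) : ∑ x, target P₀ L x = 1 := by
  simp only [target]
  rw [← Finset.sum_div, div_self (partition_pos hP₀ L).ne']

/-- One `ε` comes from the Boltzmann weight, the other from the partition function. -/
theorem exp_mul_target_le (hP₀ : ∀ x, 0 < P₀ x) {L L' : Ω → ℝ} {ε : ℝ}
    (h : ∀ x, |L' x - L x| ≤ ε) (x : Ω) :
    Real.exp (-(2 * ε)) * target P₀ L x ≤ target P₀ L' x := by
  have : Nonempty Ω := ⟨x⟩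
  have hnum : Real.exp (-ε) * (P₀ x * Real.exp (-L x)) ≤ P₀ x * Real.exp (-L' x) := by
    rw [mul_left_comm, ← Real.exp_add]
    refine mul_le_mul_of_nonneg_left (Real.exp_le_exp.2 ?_) (hP₀ x).le
    linarith [(abs_le.1 (h x)).2]
  have hden : Real.exp (-ε) * ∑ y, P₀ y * Real.exp (-L' y) ≤ ∑ y, P₀ y * Real.exp (-L y) := by
    rw [Finset.mul_sum]
    refine Finset.sum_le_sum fun y _ => ?_
    rw [mul_left_comm, ← Real.exp_add]
    refine mul_le_mul_of_nonneg_left (Real.exp_le_exp.2 ?_) (hP₀ y).le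
    linarith [(abs_le.1 (h y)).1]
  have hZ := partition_pos hP₀ L
  have hZ' := partition_pos hP₀ L'
  rw [target, target, ← mul_div_assoc, div_le_div_iff₀ hZ hZ']
  calc Real.exp (-(2 * ε)) * (P₀ x * Real.exp (-L x)) * ∑ y, P₀ y * Real.exp (-L' y)
      = (Real.exp (-ε) * (P₀ x * Real.exp (-L x))) *
          (Real.exp (-ε) * ∑ y, P₀ y * Real.exp (-L' y)) := by
        rw [show -(2 * ε) = -ε + -ε by ring, Real.exp_add]
        ring
    _ ≤ _ := mul_le_mul hnum hden
        (mul_nonneg (Real.exp_pos _).le hZ'.le)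
        (mul_pos (hP₀ x) (Real.exp_pos _)).le

theorem sum_target_sub_le [Nonempty Ω] (hP₀ : ∀ x, 0 < P₀ x) {L L' : Ω → ℝ} {ε : ℝ} (hε : 0 ≤ ε)
    (h : ∀ x, |L' x - L x| ≤ ε) (A : Finset Ω) :
    ∑ x ∈ A, target P₀ L x - ∑ x ∈ A, target P₀ L' x ≤ 2 * ε := by
  have h1 : Real.exp (-(2 * ε)) * ∑ x ∈ A, target P₀ L x ≤ ∑ x ∈ A, target P₀ L' x := by
    rw [Finset.mul_sum]
    exact Finset.sum_le_sum fun x _ => exp_mul_target_le hP₀ h x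
  have h2 : ∑ x ∈ A, target P₀ L x ≤ 1 := by
    rw [← sum_target hP₀ L]
    exact Finset.sum_le_univ_sum_of_nonneg fun x => (target_pos hP₀ L x).le
  have h3 : 0 ≤ ∑ x ∈ A, target P₀ L x := Finset.sum_nonneg fun x _ => (target_pos hP₀ L x).le
  have h4 := Real.add_one_le_exp (-(2 * ε))
  nlinarith

theorem tvDist_target_le [Nonempty Ω] (hP₀ : ∀ x, 0 < P₀ x) (L L' : Ω → ℝ) :
    tvDist (target P₀ L') (target P₀ L) ≤ 2 * ⨆ x, |L' x - L x| := by
  have h : ∀ x, |L' x - L x| ≤ ⨆ x, |L' x - L x| :=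
    le_ciSup (Set.finite_range fun x => |L' x - L x|).bddAbove
  have h' : ∀ x, |L x - L' x| ≤ ⨆ x, |L' x - L x| := fun x => abs_sub_comm (L x) (L' x) ▸ h x
  have hε : 0 ≤ ⨆ x, |L' x - L x| := Real.iSup_nonneg fun x => abs_nonneg _
  exact ciSup_le fun A => abs_sub_le_iff.2
    ⟨sum_target_sub_le hP₀ hε h' A, sum_target_sub_le hP₀ hε h A⟩

end Target

/-! ### Lower bound for the prefactor -/

theorem iInf_le_half [Nontrivial Ω] {P : Ω → ℝ} (hP : ∀ x, 0 < P x) (hPsum : ∑ x, P x = 1) :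
    ⨅ x, P x ≤ 1 / 2 := by
  classical
  obtain ⟨a, b, hab⟩ := exists_pair_ne Ω
  have hle : ∀ x, ⨅ x, P x ≤ P x := ciInf_le (Set.finite_range P).bddBelow
  have h : ∑ x ∈ {a, b}, P x ≤ ∑ x, P x := Finset.sum_le_univ_sum_of_nonneg fun x => (hP x).le
  rw [Finset.sum_pair hab, hPsum] at h
  linarith [hle a, hle b]

theorem iInf_pos [Nonempty Ω] {P : Ω → ℝ} (hP : ∀ x, 0 < P x) : 0 < ⨅ x, P x := by
  obtain ⟨x, hx⟩ := exists_eq_ciInf_of_finite (f := P)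
  exact hx ▸ hP x

/-- The ceiling can be negative when `m > 1/4`. But `log (2√m) ≤ 1/2` and `-log (1 - Δ) ≥ Δ`, so the
quotient is at least `-1/(2Δ)`, leaving `1/(2Δ) ≥ 1/2`. -/
theorem half_le_ceil_add_inv {m Δ : ℝ} (hm : 0 < m) (hm' : m ≤ 1 / 2) (hΔ : 0 < Δ) (hΔ' : Δ ≤ 1) :
    1 / 2 ≤ ((⌈Real.log (2 * √m) / Real.log (1 - Δ)⌉ : ℤ) : ℝ) + 1 / Δ := by
  have hinv : 1 ≤ 1 / Δ := (one_le_div hΔ).2 hΔ'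
  rcases hΔ'.eq_or_lt with rfl | hlt
  -- At `Δ = 1`, `log 0 = 0` and division by zero make the quotient 0.
  · norm_num
  have hlog : Real.log (1 - Δ) ≤ -Δ := by
    linarith [Real.log_le_sub_one_of_pos (sub_pos.2 hlt)]
  have hsqrt : √m ≤ 3 / 4 := Real.sqrt_le_iff.2 ⟨by norm_num, by linarith⟩
  have hnum : Real.log (2 * √m) ≤ 1 / 2 := by
    have := Real.log_le_sub_one_of_pos (mul_pos two_pos (Real.sqrt_pos.2 hm))
    linarith
  have hdiv : -(1 / 2) * (1 / Δ) ≤ Real.log (2 * √m) / Real.log (1 - Δ) := by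
    rw [le_div_iff_of_neg (by linarith)]
    have : 1 / 2 ≤ -(1 / 2) * (1 / Δ) * Real.log (1 - Δ) := by
      have : 1 / Δ * Δ ≤ 1 / Δ * -Real.log (1 - Δ) :=
        mul_le_mul_of_nonneg_left (by linarith) (by linarith)
      rw [div_mul_cancel₀ _ hΔ.ne'] at this
      linarith
    linarith
  linarith [Int.le_ceil (Real.log (2 * √m) / Real.log (1 - Δ))]

end MetropolisHastings

theorem mainTheorem6 {Ω : Type*} [Fintype Ω] [DecidableEq Ω]
    (P₀ : Ω → ℝ) (hP₀pos : ∀ x, 0 < P₀ x) (hP₀sum : ∑ x, P₀ x = 1)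
    (T : Matrix Ω Ω ℝ) (hT : ∀ x y, T x y ∈ Set.Ioo (0 : ℝ) 1) (hTsum : ∀ x, ∑ y, T x y = 1)
    (L L' : Ω → ℝ) (hL : ∀ x, 0 < L x) (hL' : ∀ x, 0 < L' x)
    (P P' : Ω → ℝ) (hP : P = MetropolisHastings.target P₀ L)
    (hP' : P' = MetropolisHastings.target P₀ L')
    (W W' : Matrix Ω Ω ℝ) (hW : W = MetropolisHastings.transition P T)
    (hW' : W' = MetropolisHastings.transition P' T)
    (Δ : ℝ) (hΔ : Δ = MetropolisHastings.spectralGap W) :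
    (∀ p : Ω → ℝ, MetropolisHastings.IsStationary W p ↔ p = P) ∧
    (∀ p : Ω → ℝ, MetropolisHastings.IsStationary W' p ↔ p = P') ∧
    (0 < Δ ∧ Δ ≤ 1) ∧
    MetropolisHastings.tvDist P' P ≤
      8 * (((⌈Real.log (2 * √(⨅ x, P x)) / Real.log (1 - Δ)⌉ : ℤ) : ℝ) + 1 / Δ) *
        ⨆ x, |L' x - L x| := by
  open MetropolisHastings in
  subst hP hP' hW hW' hΔ
  have hT0 : ∀ x y, 0 < T x y := fun x y => (hT x y).1
  have hne : Nonempty Ω := by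
    by_contra h
    rw [not_nonempty_iff] at h
    simp at hP₀sum
  -- On a single point the row sum would force `T x x = 1`.
  have hnt : Nontrivial Ω := by
    by_contra h
    rw [not_nontrivial_iff_subsingleton] at h
    obtain ⟨x⟩ := hne
    have h1 := hTsum x
    rw [Fintype.sum_subsingleton _ x] at h1
    exact (hT x x).2.ne h1
  have hpos := target_pos hP₀pos L
  have hpos' := target_pos hP₀pos L'
  have hgap := spectralGap_mem_Ioc (transition_pos hpos hT0 hTsum)
    (transition_row_sum (target P₀ L) T) hpos (transition_reversible hpos hT0)
  refine ⟨isStationary_iff (transition_pos hpos hT0 hTsum) (transition_row_sum _ T) hpos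
      (sum_target hP₀pos L) (transition_reversible hpos hT0),
    isStationary_iff (transition_pos hpos' hT0 hTsum) (transition_row_sum _ T) hpos'
      (sum_target hP₀pos L') (transition_reversible hpos' hT0), hgap, ?_⟩
  refine (tvDist_target_le hP₀pos L L').trans
    (mul_le_mul_of_nonneg_right ?_ (Real.iSup_nonneg fun x => abs_nonneg _))
  linarith [half_le_ceil_add_inv (iInf_pos hpos) (iInf_le_half hpos (sum_target hP₀pos L))
    hgap.1 hgap.2]
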